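/- Let $0\le q<1$, put $[k]_q!=\prod_{j=1}^{k}(1+q+\cdots+q^{j-1})$ and $E_q(\zeta)=\sum_{k\ge 0}\zeta^k/[k]_q!$ (convergent for $|\zeta|<\frac1{1-q}$), and let $\mathbf H_{2,q}$ be the reproducing kernel Hilbert space of functions on the disk $|z|<\frac{1}{\sqrt{1-q}}$ with reproducing kernel $E_q(z\overline w)$. Let $\mathbf H_2(\mathbb D)$ be the Hardy space of the open unit disk $\mathbb D$, i.e. the reproducing kernel Hilbert space with kernel $\frac1{1-z\overline w}$. A Schur multiplier of a reproducing kernel Hilbert space of functions on a disk is a function $s$, analytic in that disk, for which the operator $M_s\colon f\mapsto sf$ is a contraction ($\|M_s\|\le 1$) from the space into itself. (1) Let $s$ be analytic in $|z|<\frac1{\sqrt{1-q}}$. Then $M_s$ is a contractive operator from $\mathbf H_{2,q}$ into itself if and only if $\sigma(z)=s\left(\frac{z}{\sqrt{1-q}}\right)$ is a Schur function, i.e. is analytic in the open unit disk and satisfies $|\sigma(z)|\le 1$ there. (2) The Schur multipliers of $\mathbf H_{2,q}$ are exactly the functions $z\mapsto\sigma(\sqrt{1-q}\,z)$, $|z|<\frac{1}{\sqrt{1-q}}$,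 where $\sigma$ is a Schur multiplier of $\mathbf H_2(\mathbb D)$. -/

import Mathlib

noncomputable section

open ComplexConjugate Filter Topology

/-- The `q`-factorial `[k]_q! = 1 · (1 + q) · (1 + q + q²) ⋯ (1 + q + ⋯ + q^(k-1))`. -/
def qFactorial (q : ℝ) (k : ℕ) : ℝ :=
  ∏ j ∈ Finset.range k, ∑ i ∈ Finset.range (j + 1), q ^ i

/-- The `q`-exponential `E_q(ζ) = ∑ ζ^k / [k]_q!`; the series converges for `|ζ| < 1 / (1 - q)`. -/
def qExp (q : ℝ) (ζ : ℂ) : ℂ := ∑' k : ℕ, ζ ^ k / (qFactorial q k : ℂ)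

/-- The open disk of radius `R` about the origin, as a type. -/
abbrev Disk (R : ℝ) : Type := Metric.ball (0 : ℂ) R

/-- The radius `1 / √(1 - q)` of the disk on which the elements of `H_{2,q}` live. -/
def qRadius (q : ℝ) : ℝ := 1 / √(1 - q)

/-- A scalar kernel, seen as a kernel with values in the operators on `ℂ`
(`k` acts as multiplication by `k z w`). -/
def scalarKernel {X : Type} (k : X → X → ℂ) : Matrix X X (ℂ →L[ℂ] ℂ) :=
  .of fun z w ↦ k z w • ContinuousLinearMap.id ℂ ℂ

/-- The kernel `E_q(z w̄)` on `|z| < 1 / √(1 - q)`. -/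
def qKernel (q : ℝ) : Matrix (Disk (qRadius q)) (Disk (qRadius q)) (ℂ →L[ℂ] ℂ) :=
  scalarKernel fun z w ↦ qExp q ((z : ℂ) * conj (w : ℂ))

/-- The Szegő kernel `1 / (1 - z w̄)` on the open unit disk. -/
def szegoKernel : Matrix (Disk 1) (Disk 1) (ℂ →L[ℂ] ℂ) :=
  scalarKernel fun z w ↦ 1 / (1 - (z : ℂ) * conj (w : ℂ))

theorem qFactorial_pos {q : ℝ} (hq : 0 ≤ q) (k : ℕ) : 0 < qFactorial q k := by
  refine Finset.prod_pos fun j _ ↦ ?_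
  rw [Finset.sum_range_succ']
  have : 0 ≤ ∑ i ∈ Finset.range j, q ^ (i + 1) := Finset.sum_nonneg fun i _ ↦ by positivity
  simp only [pow_zero]
  linarith

theorem summable_qExp {q : ℝ} (hq0 : 0 ≤ q) (hq1 : q < 1) {ζ : ℂ} (hζ : ‖ζ‖ < 1 / (1 - q)) :
    Summable fun k : ℕ ↦ ζ ^ k / (qFactorial q k : ℂ) := by
  rcases eq_or_ne ζ 0 with rfl | h0
  · refine summable_of_ne_finset_zero (s := {0}) fun k hk ↦ ?_
    have : k ≠ 0 := by simpa using hk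
    simp [this]
  have hpos := fun k ↦ qFactorial_pos hq0 k
  refine summable_of_ratio_test_tendsto_lt_one (l := ‖ζ‖ * (1 - q)) ?_ ?_ ?_
  · rwa [lt_div_iff₀ (by linarith)] at hζ
  · refine Eventually.of_forall fun k ↦ ?_
    have := (hpos k).ne'
    simp [h0, this]
  · have hlim : Tendsto (fun k : ℕ ↦ ‖ζ‖ * (∑ i ∈ Finset.range (k + 1), q ^ i)⁻¹) atTop
        (𝓝 (‖ζ‖ * (1 - q))) := by
      have h1 := (hasSum_geometric_of_lt_one hq0 hq1).tendsto_sum_nat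
      have h2 := (h1.comp (tendsto_add_atTop_nat 1)).inv₀
        (inv_ne_zero (by linarith : (1 - q) ≠ 0))
      rw [inv_inv] at h2
      exact h2.const_mul _
    refine hlim.congr fun k ↦ ?_
    have hk := hpos k
    have hk1 := hpos (k + 1)
    have hs : qFactorial q (k + 1) = qFactorial q k * ∑ i ∈ Finset.range (k + 1), q ^ i := by
      simp [qFactorial, Finset.prod_range_succ]
    have hsum : (∑ i ∈ Finset.range (k + 1), q ^ i) ≠ 0 := by
      intro h
      rw [hs, h, mul_zero] at hk1
      exact lt_irrefl _ hk1
    have hn : ‖ζ‖ ≠ 0 := by simpa using h0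
    rw [norm_div, norm_div, norm_pow, norm_pow, Complex.norm_real, Complex.norm_real,
      Real.norm_of_nonneg hk.le, Real.norm_of_nonneg hk1.le, hs]
    have hk' := hk.ne'
    field_simp
    ring

open scoped ComplexOrder in
/-- A kernel given by a power series in `z w̄` with nonnegative coefficients is positive. -/
theorem posSemidef_scalarKernel {R : ℝ} {k : Disk R → Disk R → ℂ} {c : ℕ → ℝ}
    (hc : ∀ n, 0 ≤ c n)
    (hk : ∀ z w : Disk R, HasSum (fun n ↦ (c n : ℂ) * ((z : ℂ) * conj (w : ℂ)) ^ n) (k z w)) :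
    (scalarKernel k).PosSemidef := by
  have htfae := (RKHS.posSemidef_tfae (K := scalarKernel k)).out 0 2
  refine htfae.mpr ⟨?_, fun v ↦ ?_⟩
  · ext z w
    have h1 := (hk w z).map (starRingEnd ℂ) Complex.continuous_conj
    have h2 : k z w = conj (k w z) := by
      refine (hk z w).unique (h1.congr_fun ?_)
      intro n
      simp [mul_comm]
    have h3 : star (ContinuousLinearMap.id ℂ ℂ) = ContinuousLinearMap.id ℂ ℂ :=
      star_one (ℂ →L[ℂ] ℂ)
    simp [scalarKernel, Matrix.conjTranspose_apply, h2, h3]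
  · have key : HasSum (fun n ↦ ((c n * ‖v.sum fun x a ↦ a * conj (x : ℂ) ^ n‖ ^ 2 : ℝ) : ℂ))
        (v.sum fun x w ↦ v.sum fun x' w' ↦ inner ℂ (scalarKernel k x' x w) w') := by
      have : HasSum (fun n ↦ ∑ x ∈ v.support, ∑ x' ∈ v.support,
          conj ((c n : ℂ) * ((x' : ℂ) * conj (x : ℂ)) ^ n) * (conj (v x) * v x'))
          (∑ x ∈ v.support, ∑ x' ∈ v.support, conj (k x' x) * (conj (v x) * v x')) := by
        refine hasSum_sum fun x _ ↦ hasSum_sum fun x' _ ↦ ?_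
        exact ((hk x' x).map (starRingEnd ℂ) Complex.continuous_conj).mul_right _
      convert this using 1
      · funext n
        rw [Complex.ofReal_mul, Complex.ofReal_pow, ← Complex.conj_mul', Finsupp.sum, map_sum,
          Finset.sum_mul_sum, Finset.mul_sum]
        refine Finset.sum_congr rfl fun x _ ↦ ?_
        rw [Finset.mul_sum]
        refine Finset.sum_congr rfl fun x' _ ↦ ?_
        simp [mul_pow]
        ring
      · simp only [Finsupp.sum]
        refine Finset.sum_congr rfl fun x _ ↦ Finset.sum_congr rfl fun x' _ ↦ ?_
        simp [scalarKernel]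
        ring
    have h2 := Complex.hasSum_re key
    exact h2.nonneg fun n ↦ by
      rw [Complex.ofReal_re]
      exact mul_nonneg (hc n) (by positivity)

theorem norm_mul_conj_lt {R : ℝ} (z w : Disk R) : ‖(z : ℂ) * conj (w : ℂ)‖ < R ^ 2 := by
  have hz : ‖(z : ℂ)‖ < R := mem_ball_zero_iff.1 z.2
  have hw : ‖(w : ℂ)‖ < R := mem_ball_zero_iff.1 w.2
  rw [norm_mul, RCLike.norm_conj, sq]
  exact mul_lt_mul'' hz hw (norm_nonneg _) (norm_nonneg _)

open scoped ComplexOrder in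
instance (q : Set.Ico (0 : ℝ) 1) : Fact (qKernel (q : ℝ)).PosSemidef := by
  obtain ⟨q, hq0, hq1⟩ := q
  refine ⟨posSemidef_scalarKernel (c := fun n ↦ (qFactorial q n)⁻¹)
    (fun n ↦ (inv_pos.2 (qFactorial_pos hq0 n)).le) fun z w ↦ ?_⟩
  have hR : qRadius q ^ 2 = 1 / (1 - q) := by
    rw [qRadius, div_pow, one_pow, Real.sq_sqrt (by linarith)]
  have h := (norm_mul_conj_lt z w).trans_eq hR
  refine (summable_qExp hq0 hq1 h).hasSum.congr_fun fun n ↦ ?_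
  rw [Complex.ofReal_inv, div_eq_mul_inv, mul_comm]

open scoped ComplexOrder in
instance : Fact szegoKernel.PosSemidef := by
  refine ⟨posSemidef_scalarKernel (c := fun _ ↦ 1) (fun _ ↦ zero_le_one) fun z w ↦ ?_⟩
  have h := norm_mul_conj_lt z w
  rw [one_pow] at h
  simpa using hasSum_geometric_of_norm_lt_one h

/-- `H_{2,q}`, the reproducing kernel Hilbert space with kernel `E_q(z w̄)`, for `0 ≤ q < 1`. -/
abbrev H2q (q : Set.Ico (0 : ℝ) 1) : Type := RKHS.OfKernel (qKernel (q : ℝ))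

/-- The Hardy space of the unit disk, the reproducing kernel Hilbert space with the Szegő kernel. -/
abbrev HardyH2 : Type := RKHS.OfKernel szegoKernel

/-- Multiplication by `s` is a contractive operator from the reproducing kernel Hilbert space `H`
of functions on the disk of radius `R` into itself. -/
def IsContractiveMulOp {R : ℝ} (H : Type) [NormedAddCommGroup H] [InnerProductSpace ℂ H]
    [RKHS ℂ H (Disk R) ℂ] (s : ℂ → ℂ) : Prop :=
  ∃ M : H →L[ℂ] H, (∀ (f : H) (z : Disk R), M f z = s z * f z) ∧ ‖M‖ ≤ 1

/-- A Schur multiplier of `H`: an analytic function on the disk of radius `R` such that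
multiplication by it is a contraction of `H`. -/
def IsSchurMultiplier {R : ℝ} (H : Type) [NormedAddCommGroup H] [InnerProductSpace ℂ H]
    [RKHS ℂ H (Disk R) ℂ] (s : ℂ → ℂ) : Prop :=
  AnalyticOnNhd ℂ s (Metric.ball 0 R) ∧ IsContractiveMulOp H s

/-- A Schur function: analytic and bounded by one in modulus in the open unit disk. -/
def IsSchurFunction (σ : ℂ → ℂ) : Prop :=
  AnalyticOnNhd ℂ σ (Metric.ball 0 1) ∧ ∀ z ∈ Metric.ball (0 : ℂ) 1, ‖σ z‖ ≤ 1

end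

open ComplexConjugate Filter Topology

/-! After rescaling to the unit disk, `E_q(z w̄)` becomes `∑ bₙ (z w̄)ⁿ` with `bₙ = 1 / ([n]_q! (1 -
q)ⁿ)`. Since `bₙ₊₁ / bₙ = 1 / (1 - qⁿ⁺¹) ≥ 1`, the weights are nondecreasing, and this is the only
property of `E_q` that matters.

Necessity: kernel functions are eigenvectors of the adjoint of `M_s`, with eigenvalues `conj (s z)`,
so a contraction forces `|s| ≤ 1` (`IsContractiveMulOp.norm_le_one`).

Sufficiency: the norm squared of `∑ cᵢ k_{wᵢ}` is `∑ bₙ |mₙ|²` with moments `mₙ = ∑ cᵢ conj(wᵢ)ⁿ`,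
and the adjoint replaces `cᵢ` by `cᵢ conj(σ(wᵢ))`. For `bₙ = 1` this contracts, by positivity of the
Pick kernel (`IsSchurFunction.pick_nonneg`). The map on moments commutes with the backward shift, so
every tail sum contracts too. Summation by parts then gives the inequality for all nondecreasing
weights (`IsSchurFunction.tsum_weighted_moments_le`), and density of kernel functions finishes.

The Hardy space is the case of constant weights, so both spaces have the same multipliers up to
scaling. -/

/-! ### Positivity of the Pick kernel -/

/-- The Szegő kernel reproduces functions analytic in the disk and continuous on its closure. -/
theorem circleAverage_conj_szego_mul {f : ℂ → ℂ} (hf : DiffContOnCl ℂ f (Metric.ball 0 1)) {w : ℂ}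
    (hw : w ∈ Metric.ball (0 : ℂ) 1) :
    Real.circleAverage (fun z ↦ conj (1 / (1 - z * conj w)) * f z) 0 1 = f w := by
  have h := DiffContOnCl.circleAverage_smul_div (R := 1) (c := 0) (f := f) (w := w)
    (by simpa using hf) (by simpa using hw)
  rw [← h]
  refine Real.circleAverage_congr_sphere fun z hz ↦ ?_
  have hz1 : ‖z‖ = 1 := by simpa using hz
  have hw1 : ‖w‖ < 1 := by simpa using hw
  have hzw : z - w ≠ 0 := by
    intro h0
    rw [sub_eq_zero.1 h0] at hz1
    linarith
  have hz0 : z ≠ 0 := by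
    rintro rfl
    simp at hz1
  -- On the circle the conjugated Szegő kernel is therefore `z / (z - w)`, the Cauchy kernel for
  -- circle averages.
  have hconj : conj z = z⁻¹ := by
    rw [Complex.inv_def, Complex.normSq_eq_norm_sq, hz1]
    simp
  have h1 : 1 - z⁻¹ * w = (z - w) / z := by field_simp
  simp [hconj, h1]

/-- A finite combination of Szegő kernel functions. -/
noncomputable def szegoComb {ι : Type*} (S : Finset ι) (c w : ι → ℂ) (z : ℂ) : ℂ :=
  ∑ i ∈ S, c i * (1 / (1 - z * conj (w i)))

theorem diffContOnCl_szegoComb {ι : Type*} (S : Finset ι) (c w : ι → ℂ)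
    (hw : ∀ i ∈ S, w i ∈ Metric.ball (0 : ℂ) 1) :
    DiffContOnCl ℂ (szegoComb S c w) (Metric.ball 0 1) := by
  refine DifferentiableOn.diffContOnCl fun z hz ↦ ?_
  rw [closure_ball _ one_ne_zero] at hz
  refine DifferentiableAt.differentiableWithinAt ?_
  unfold szegoComb
  refine DifferentiableAt.fun_sum fun i hi ↦ ?_
  have h1 : ‖w i‖ < 1 := by simpa using hw i hi
  have h2 : ‖z‖ ≤ 1 := by simpa using hz
  have hne : 1 - z * conj (w i) ≠ 0 := by
    intro h0
    have : ‖z * conj (w i)‖ = 1 := by rw [← sub_eq_zero.1 h0]; simp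
    rw [norm_mul, RCLike.norm_conj] at this
    nlinarith [norm_nonneg z, norm_nonneg (w i)]
  fun_prop (disch := exact hne)

theorem DiffContOnCl.circleIntegrable_conj_mul {f g : ℂ → ℂ}
    (hf : DiffContOnCl ℂ f (Metric.ball 0 1)) (hg : DiffContOnCl ℂ g (Metric.ball 0 1)) :
    CircleIntegrable (fun z ↦ conj (f z) * g z) 0 1 := by
  refine ContinuousOn.circleIntegrable zero_le_one ?_
  have hs : Metric.sphere (0 : ℂ) 1 ⊆ closure (Metric.ball 0 1) := by
    rw [closure_ball _ one_ne_zero]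
    exact Metric.sphere_subset_closedBall
  exact (Complex.continuous_conj.comp_continuousOn (hf.continuousOn.mono hs)).mul
    (hg.continuousOn.mono hs)

theorem circleAverage_conj_szegoComb_mul {ι : Type*} (S : Finset ι) (c w : ι → ℂ)
    (hw : ∀ i ∈ S, w i ∈ Metric.ball (0 : ℂ) 1) {f : ℂ → ℂ}
    (hf : DiffContOnCl ℂ f (Metric.ball 0 1)) :
    Real.circleAverage (fun z ↦ conj (szegoComb S c w z) * f z) 0 1 =
      ∑ i ∈ S, conj (c i) * f (w i) := by
  have hone : ∀ i ∈ S, DiffContOnCl ℂ (fun z ↦ 1 / (1 - z * conj (w i))) (Metric.ball 0 1) := by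
    intro i hi
    have := diffContOnCl_szegoComb {i} (fun _ ↦ 1) w (by simpa using hw i hi)
    convert! this using 2
    simp [szegoComb]
  have : (fun z ↦ conj (szegoComb S c w z) * f z) =
      fun z ↦ ∑ i ∈ S, conj (c i) • (conj (1 / (1 - z * conj (w i))) * f z) := by
    funext z
    simp only [szegoComb, map_sum, Finset.sum_mul, map_mul, smul_eq_mul, mul_assoc]
  rw [this, Real.circleAverage_fun_sum]
  · refine Finset.sum_congr rfl fun i hi ↦ ?_
    rw [Real.circleAverage_fun_smul, circleAverage_conj_szego_mul hf (hw i hi), smul_eq_mul]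
  · intro i hi
    exact ((hone i hi).circleIntegrable_conj_mul hf).const_fun_smul

/-- Positivity of the Pick kernel for functions continuous on the closed disk. -/
theorem DiffContOnCl.pick_nonneg {σ : ℂ → ℂ} (hσ : DiffContOnCl ℂ σ (Metric.ball 0 1))
    (hσ1 : ∀ z ∈ Metric.sphere (0 : ℂ) 1, ‖σ z‖ ≤ 1) {ι : Type*} (S : Finset ι) (c w : ι → ℂ)
    (hw : ∀ i ∈ S, w i ∈ Metric.ball (0 : ℂ) 1) :
    0 ≤ (∑ i ∈ S, conj (c i) * (szegoComb S c w (w i) -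
      σ (w i) * szegoComb S (fun i ↦ c i * conj (σ (w i))) w (w i))).re := by
  set F := szegoComb S c w with hF
  set G := szegoComb S (fun i ↦ c i * conj (σ (w i))) w with hG
  have hFd : DiffContOnCl ℂ F (Metric.ball 0 1) := diffContOnCl_szegoComb S _ w hw
  have hGd : DiffContOnCl ℂ G (Metric.ball 0 1) := diffContOnCl_szegoComb S _ w hw
  -- The averages of `conj F * σ * G` and of `|G|²` both equal `∑ conj(cᵢ) σ(wᵢ) G(wᵢ)`. With the
  -- factor 2, adding `|G|²` leaves exactly one copy subtracted, and the real part of the integrand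
  -- completes to a square.
  have hd : DiffContOnCl ℂ (fun z ↦ F z - 2 * (σ z * G z)) (Metric.ball 0 1) := by
    have := hFd.sub ((hσ.smul hGd).const_smul (2 : ℂ))
    simpa [Pi.sub_def, Pi.smul_def] using this
  have hI1 := hFd.circleIntegrable_conj_mul hd
  have hI2 := hGd.circleIntegrable_conj_mul hGd
  have h1 := circleAverage_conj_szegoComb_mul S c w hw hd
  have h2 := circleAverage_conj_szegoComb_mul S (fun i ↦ c i * conj (σ (w i))) w hw hGd
  have h3 := Real.circleAverage_fun_add hI1 hI2
  rw [h1, h2, ← Finset.sum_add_distrib] at h3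
  have h4 : ∑ i ∈ S, conj (c i) * (F (w i) - σ (w i) * G (w i)) =
      Real.circleAverage (fun z ↦ conj (F z) * (F z - 2 * (σ z * G z)) + conj (G z) * G z) 0 1 := by
    rw [h3]
    refine Finset.sum_congr rfl fun i _ ↦ ?_
    simp only [map_mul, Complex.conj_conj]
    ring
  have hI : IntervalIntegrable (fun θ ↦ conj (F (circleMap 0 1 θ)) * (F (circleMap 0 1 θ) -
      2 * (σ (circleMap 0 1 θ) * G (circleMap 0 1 θ))) +
      conj (G (circleMap 0 1 θ)) * G (circleMap 0 1 θ)) MeasureTheory.volume 0 (2 * Real.pi) :=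
    hI1.add hI2
  rw [h4, Real.circleAverage_def, Complex.smul_re, ← Complex.reCLM_apply,
    ← ContinuousLinearMap.intervalIntegral_comp_comm _ hI]
  refine smul_nonneg (by positivity) (intervalIntegral.integral_nonneg (by positivity) fun θ _ ↦ ?_)
  set z := circleMap 0 1 θ
  have hz := hσ1 z (circleMap_mem_sphere _ zero_le_one _)
  have e1 : (conj (F z) * (F z - 2 * (σ z * G z)) + conj (G z) * G z).re =
      ‖F z - σ z * G z‖ ^ 2 + (1 - ‖σ z‖ ^ 2) * ‖G z‖ ^ 2 := by
    simp only [← Complex.normSq_eq_norm_sq, Complex.normSq_apply]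
    simp
    ring
  show 0 ≤ (conj (F z) * (F z - 2 * (σ z * G z)) + conj (G z) * G z).re
  rw [e1]
  have : ‖σ z‖ ^ 2 ≤ 1 := pow_le_one₀ (norm_nonneg _) hz
  have := mul_nonneg (sub_nonneg.2 this) (sq_nonneg ‖G z‖)
  positivity

/-- Positivity of the Pick kernel of a Schur function. -/
theorem IsSchurFunction.pick_nonneg {σ : ℂ → ℂ} (hσ : IsSchurFunction σ) {ι : Type*}
    (S : Finset ι) (c w : ι → ℂ) (hw : ∀ i ∈ S, w i ∈ Metric.ball (0 : ℂ) 1) :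
    0 ≤ (∑ i ∈ S, conj (c i) * (szegoComb S c w (w i) -
      σ (w i) * szegoComb S (fun i ↦ c i * conj (σ (w i))) w (w i))).re := by
  have hlim : ∀ i ∈ S, Tendsto (fun r : ℝ ↦ σ (r * w i)) (𝓝[<] 1) (𝓝 (σ (w i))) := by
    intro i hi
    have h1 : ContinuousAt (fun r : ℝ ↦ σ (r * w i)) 1 := by
      refine ContinuousAt.comp (g := σ) (f := fun r : ℝ ↦ (r : ℂ) * w i) ?_ (by fun_prop)
      simpa using (hσ.1 _ (hw i hi)).continuousAt
    simpa using h1.tendsto.mono_left nhdsWithin_le_nhds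
  have hT : Tendsto (fun r : ℝ ↦ (∑ i ∈ S, conj (c i) * (szegoComb S c w (w i) -
      σ (r * w i) * szegoComb S (fun i ↦ c i * conj (σ (r * w i))) w (w i))).re) (𝓝[<] 1)
      (𝓝 (∑ i ∈ S, conj (c i) * (szegoComb S c w (w i) -
      σ (w i) * szegoComb S (fun i ↦ c i * conj (σ (w i))) w (w i))).re) := by
    refine (Complex.continuous_re.tendsto _).comp (tendsto_finsetSum _ fun i hi ↦ ?_)
    refine (((hlim i hi).mul (tendsto_finsetSum _ fun j hj ↦ ?_)).const_sub _).const_mul _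
    exact (((Complex.continuous_conj.tendsto _).comp (hlim j hj)).const_mul _).mul_const _
  -- The dilates `σ(r ·)`, `0 < r < 1`, are analytic on the closed disk; positivity passes to `r →
  -- 1` because only finitely many points are involved.
  refine ge_of_tendsto hT ?_
  filter_upwards [Ioo_mem_nhdsLT (zero_lt_one (α := ℝ))] with r hr
  have hmem : ∀ z : ℂ, ‖z‖ ≤ 1 → (r : ℂ) * z ∈ Metric.ball (0 : ℂ) 1 := by
    intro z hz
    rw [mem_ball_zero_iff, norm_mul, Complex.norm_real, Real.norm_of_nonneg hr.1.le]
    nlinarith [hr.1, hr.2, norm_nonneg z]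
  refine DiffContOnCl.pick_nonneg (σ := fun z ↦ σ (r * z)) ?_ (fun z hz ↦ ?_) S c w hw
  · refine DifferentiableOn.diffContOnCl fun z hz ↦ ?_
    rw [closure_ball _ one_ne_zero, mem_closedBall_zero_iff] at hz
    refine DifferentiableAt.differentiableWithinAt ?_
    exact ((hσ.1 _ (hmem z hz)).differentiableAt).comp z (by fun_prop)
  · exact hσ.2 _ (hmem z (by simpa using (mem_sphere_zero_iff_norm.1 hz).le))

/-! ### Moment sequences and domination of tails -/

/-- Expanding the kernel in powers turns the Gram form into a weighted `ℓ²` norm of the moments. -/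
theorem hasSum_weighted_moments {ι : Type*} (S : Finset ι) (c w : ι → ℂ) {b : ℕ → ℝ}
    {k : ι → ι → ℂ}
    (hk : ∀ i ∈ S, ∀ j ∈ S, HasSum (fun n ↦ (b n : ℂ) * (w i * conj (w j)) ^ n) (k i j)) :
    HasSum (fun n ↦ b n * ‖∑ i ∈ S, c i * conj (w i) ^ n‖ ^ 2)
      (∑ i ∈ S, conj (c i) * ∑ j ∈ S, c j * k i j).re := by
  have h : HasSum (fun n ↦ ∑ i ∈ S, conj (c i) * ∑ j ∈ S, c j * ((b n : ℂ) *
      (w i * conj (w j)) ^ n)) (∑ i ∈ S, conj (c i) * ∑ j ∈ S, c j * k i j) :=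
    hasSum_sum fun i hi ↦ (hasSum_sum fun j hj ↦ (hk i hi j hj).mul_left _).mul_left _
  refine (Complex.hasSum_re h).congr_fun fun n ↦ ?_
  rw [← Complex.ofReal_re (b n * _), Complex.ofReal_mul, Complex.ofReal_pow, ← Complex.conj_mul',
    map_sum, Finset.sum_mul_sum, Finset.mul_sum]
  congr 1
  refine Finset.sum_congr rfl fun i _ ↦ ?_
  rw [Finset.mul_sum, Finset.mul_sum]
  refine Finset.sum_congr rfl fun j _ ↦ ?_
  simp [mul_pow]
  ring

/-- If all tails of `x` are dominated by the tails of `y`, then so are the sums with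
nondecreasing weights. -/
theorem ENNReal.tsum_sum_range_mul_le_of_tail_le {x y : ℕ → ENNReal} (d : ℕ → ENNReal)
    (h : ∀ N, ∑' n, x (n + N) ≤ ∑' n, y (n + N)) :
    ∑' n, (∑ k ∈ Finset.range (n + 1), d k) * x n ≤
      ∑' n, (∑ k ∈ Finset.range (n + 1), d k) * y n := by
  -- Summation by parts as an exchange of sums: `d k` meets exactly the terms with `n ≥ k`.
  have key : ∀ x : ℕ → ENNReal, ∑' n, (∑ k ∈ Finset.range (n + 1), d k) * x n =
      ∑' k, d k * ∑' n, x (n + k) := by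
    intro x
    have h1 : ∀ n, (∑ k ∈ Finset.range (n + 1), d k) * x n =
        ∑' k, if k ≤ n then d k * x n else 0 := by
      intro n
      rw [tsum_eq_sum (s := Finset.range (n + 1)), Finset.sum_mul]
      · refine Finset.sum_congr rfl fun k hk ↦ ?_
        rw [if_pos (by simpa [Nat.lt_succ_iff] using hk)]
      · intro k hk
        rw [if_neg (by simpa [Nat.lt_succ_iff] using hk)]
    simp_rw [h1]
    rw [ENNReal.tsum_comm]
    refine tsum_congr fun k ↦ ?_
    have h2 := Summable.sum_add_tsum_nat_add' (k := k)
      (f := fun n ↦ if k ≤ n then d k * x n else 0) ENNReal.summable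
    have h3 : ∑ n ∈ Finset.range k, (if k ≤ n then d k * x n else 0) = 0 :=
      Finset.sum_eq_zero fun n hn ↦ if_neg (by simpa using hn)
    rw [← h2, h3, zero_add, ← ENNReal.tsum_mul_left]
    simp
  rw [key, key]
  exact ENNReal.tsum_le_tsum fun k ↦ mul_le_mul_right (h k) (d k)

theorem tsum_monotone_mul_le_of_tail_le {x y b : ℕ → ℝ} (hx : ∀ n, 0 ≤ x n) (hy : ∀ n, 0 ≤ y n)
    (hb : Monotone b) (hb0 : 0 ≤ b 0) (hxs : Summable x) (hys : Summable y)
    (hys' : Summable fun n ↦ b n * y n) (hxs' : Summable fun n ↦ b n * x n)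
    (h : ∀ N, ∑' n, x (n + N) ≤ ∑' n, y (n + N)) :
    ∑' n, b n * x n ≤ ∑' n, b n * y n := by
  have hbn : ∀ n, 0 ≤ b n := fun n ↦ hb0.trans (hb (Nat.zero_le n))
  obtain ⟨d, hd0, hd⟩ : ∃ d : ℕ → ℝ, (∀ k, 0 ≤ d k) ∧
      ∀ n, b n = ∑ k ∈ Finset.range (n + 1), d k := by
    -- The increments of `b`, with `d 0 = b 0`; the case split is needed because `0 - 1 = 0` in `ℕ`.
    refine ⟨fun k ↦ b k - if k = 0 then 0 else b (k - 1), fun k ↦ ?_, fun n ↦ ?_⟩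
    · rcases k with _ | k
      · simpa using hb0
      · simpa using hb (Nat.le_succ k)
    · rw [Finset.sum_range_succ']
      have := Finset.sum_range_sub b n
      simp only [Nat.succ_ne_zero, if_false, if_true, Nat.add_sub_cancel, this]
      ring
  have hw : ∀ z : ℕ → ℝ, (∀ n, 0 ≤ z n) → ∀ n, ENNReal.ofReal (b n * z n) =
      (∑ k ∈ Finset.range (n + 1), ENNReal.ofReal (d k)) * ENNReal.ofReal (z n) := by
    intro z hz n
    rw [ENNReal.ofReal_mul (hbn n), hd n, ENNReal.ofReal_sum_of_nonneg fun k _ ↦ hd0 k]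
  rw [← ENNReal.ofReal_le_ofReal_iff (tsum_nonneg fun n ↦ mul_nonneg (hbn n) (hy n)),
    ENNReal.ofReal_tsum_of_nonneg (fun n ↦ mul_nonneg (hbn n) (hx n)) hxs',
    ENNReal.ofReal_tsum_of_nonneg (fun n ↦ mul_nonneg (hbn n) (hy n)) hys']
  simp_rw [hw x hx, hw y hy]
  refine ENNReal.tsum_sum_range_mul_le_of_tail_le _ fun N ↦ ?_
  rw [← ENNReal.ofReal_tsum_of_nonneg (fun n ↦ hx _) ((summable_nat_add_iff N).2 hxs),
    ← ENNReal.ofReal_tsum_of_nonneg (fun n ↦ hy _) ((summable_nat_add_iff N).2 hys)]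
  exact ENNReal.ofReal_le_ofReal (h N)

theorem hasSum_szego {z w : ℂ} (hz : z ∈ Metric.ball (0 : ℂ) 1) (hw : w ∈ Metric.ball (0 : ℂ) 1) :
    HasSum (fun n ↦ ((1 : ℝ) : ℂ) * (z * conj w) ^ n) (1 / (1 - z * conj w)) := by
  have h := norm_mul_conj_lt (R := 1) ⟨z, hz⟩ ⟨w, hw⟩
  rw [one_pow] at h
  simpa using hasSum_geometric_of_norm_lt_one h

theorem hasSum_sq_moments {ι : Type*} (S : Finset ι) (c w : ι → ℂ)
    (hw : ∀ i ∈ S, w i ∈ Metric.ball (0 : ℂ) 1) :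
    HasSum (fun n ↦ ‖∑ i ∈ S, c i * conj (w i) ^ n‖ ^ 2)
      (∑ i ∈ S, conj (c i) * szegoComb S c w (w i)).re := by
  have h := hasSum_weighted_moments S c w (b := fun _ ↦ 1)
    fun i hi j hj ↦ hasSum_szego (hw i hi) (hw j hj)
  simp only [one_mul] at h
  exact h

/-- The co-analytic Toeplitz operator of a Schur function is a contraction of `ℓ²`. -/
theorem IsSchurFunction.tsum_sq_moments_le {σ : ℂ → ℂ} (hσ : IsSchurFunction σ) {ι : Type*}
    (S : Finset ι) (c w : ι → ℂ) (hw : ∀ i ∈ S, w i ∈ Metric.ball (0 : ℂ) 1) :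
    ∑' n, ‖∑ i ∈ S, c i * conj (σ (w i)) * conj (w i) ^ n‖ ^ 2 ≤
      ∑' n, ‖∑ i ∈ S, c i * conj (w i) ^ n‖ ^ 2 := by
  rw [(hasSum_sq_moments S c w hw).tsum_eq, (hasSum_sq_moments S _ w hw).tsum_eq]
  have h := hσ.pick_nonneg S c w hw
  simp only [mul_sub, Finset.sum_sub_distrib, Complex.sub_re, ← mul_assoc] at h
  simpa [mul_assoc] using h

/-- Multiplication by a Schur function contracts every weighted space whose kernel has
nondecreasing coefficients. -/
theorem IsSchurFunction.tsum_weighted_moments_le {σ : ℂ → ℂ} (hσ : IsSchurFunction σ) {ι : Type*}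
    (S : Finset ι) (c w : ι → ℂ) (hw : ∀ i ∈ S, w i ∈ Metric.ball (0 : ℂ) 1) {b : ℕ → ℝ}
    (hb : Monotone b) (hb0 : 0 ≤ b 0)
    (hs : ∀ i ∈ S, ∀ j ∈ S, Summable fun n ↦ (b n : ℂ) * (w i * conj (w j)) ^ n) :
    ∑' n, b n * ‖∑ i ∈ S, c i * conj (σ (w i)) * conj (w i) ^ n‖ ^ 2 ≤
      ∑' n, b n * ‖∑ i ∈ S, c i * conj (w i) ^ n‖ ^ 2 := by
  have hk := fun c : ι → ℂ ↦
    (hasSum_weighted_moments S c w fun i hi j hj ↦ (hs i hi j hj).hasSum).summable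
  refine tsum_monotone_mul_le_of_tail_le (fun n ↦ by positivity) (fun n ↦ by positivity) hb hb0
    (hasSum_sq_moments S _ w hw).summable (hasSum_sq_moments S _ w hw).summable (hk _) (hk _)
    fun N ↦ ?_
  -- Multiplying `cᵢ` by `conj(wᵢ)^N` shifts both moment sequences by `N`, so the unweighted bound
  -- becomes a bound on tails.
  have h := hσ.tsum_sq_moments_le S (fun i ↦ c i * conj (w i) ^ N) w hw
  have e1 : ∀ i n, c i * conj (w i) ^ N * conj (w i) ^ n = c i * conj (w i) ^ (n + N) :=
    fun i n ↦ by ring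
  have e2 : ∀ i n, c i * conj (w i) ^ N * conj (σ (w i)) * conj (w i) ^ n =
      c i * conj (σ (w i)) * conj (w i) ^ (n + N) := fun i n ↦ by ring
  simpa only [e1, e2] using h

/-! ### Contractive multipliers of kernel spaces on a disk -/

section Multipliers

variable {R : ℝ} {H : Type} [NormedAddCommGroup H] [InnerProductSpace ℂ H]
  [RKHS ℂ H (Disk R) ℂ] [CompleteSpace H]

theorem RKHS.inner_kerFun_one_kerFun_one {k : Disk R → Disk R → ℂ}
    (hk : RKHS.kernel H = scalarKernel k) (x y : Disk R) :
    inner ℂ (RKHS.kerFun H x (1 : ℂ)) (RKHS.kerFun H y (1 : ℂ)) = k x y := by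
  rw [RKHS.kerFun_inner, RKHS.kerFun_apply, hk]
  simp [scalarKernel]

theorem RKHS.norm_sq_sum_kerFun_one {k : Disk R → Disk R → ℂ}
    (hk : RKHS.kernel H = scalarKernel k) (S : Finset (Disk R)) (c : Disk R → ℂ) :
    ‖∑ x ∈ S, c x • RKHS.kerFun H x (1 : ℂ)‖ ^ 2 =
      (∑ x ∈ S, conj (c x) * ∑ y ∈ S, c y * k x y).re := by
  rw [← inner_self_eq_norm_sq (𝕜 := ℂ), sum_inner, RCLike.re_eq_complex_re]
  congr 1
  refine Finset.sum_congr rfl fun x _ ↦ ?_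
  rw [inner_sum, Finset.mul_sum]
  refine Finset.sum_congr rfl fun y _ ↦ ?_
  rw [inner_smul_left, inner_smul_right, RKHS.inner_kerFun_one_kerFun_one hk]

variable (H) in
theorem RKHS.denseRange_linearCombination_kerFun_one :
    DenseRange (Finsupp.linearCombination ℂ fun x : Disk R ↦ RKHS.kerFun H x (1 : ℂ)) := by
  have h := RKHS.kerFun_dense (𝕜 := ℂ) (X := Disk R) (V := ℂ) H
  rw [← Submodule.dense_iff_topologicalClosure_eq_top] at h
  refine h.mono ?_
  rw [← LinearMap.coe_range, Finsupp.range_linearCombination, SetLike.coe_subset_coe,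
    Submodule.span_le]
  rintro _ ⟨x, v, rfl⟩
  have : RKHS.kerFun H x v = v • RKHS.kerFun H x (1 : ℂ) := by
    rw [← map_smul, smul_eq_mul, mul_one]
  rw [this]
  exact Submodule.smul_mem _ _ (Submodule.subset_span ⟨x, rfl⟩)

theorem IsContractiveMulOp.norm_le_one {s : ℂ → ℂ} (h : IsContractiveMulOp (R := R) H s)
    {z : Disk R} (hz : RKHS.kernel H z z ≠ 0) : ‖s z‖ ≤ 1 := by
  obtain ⟨M, hM, hM1⟩ := h
  set κ := RKHS.kerFun H z (1 : ℂ) with hκ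
  -- The kernel function at `z` is an eigenvector of the adjoint.
  have hadj : M.adjoint κ = conj (s z) • κ := by
    refine ext_inner_right ℂ fun f ↦ ?_
    rw [ContinuousLinearMap.adjoint_inner_left, RKHS.kerFun_inner, hM, inner_smul_left,
      RKHS.kerFun_inner]
    simp
  have hκ0 : κ ≠ 0 := by
    intro h0
    refine hz (ContinuousLinearMap.ext_ring ?_)
    rw [← RKHS.kerFun_apply, ← hκ, h0]
    simp
  have h1 := (M.adjoint.le_opNorm κ).trans (mul_le_mul_of_nonneg_right
    ((LinearIsometryEquiv.norm_map ContinuousLinearMap.adjoint M).le.trans hM1) (norm_nonneg κ))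
  rw [hadj, norm_smul, RCLike.norm_conj] at h1
  exact le_of_mul_le_mul_right h1 (norm_pos_iff.2 hκ0)

/-- If `∑ cₓ kₓ ↦ ∑ cₓ conj (s x) kₓ` does not increase norms, then multiplication by `s` is a
contraction. -/
theorem isContractiveMulOp_of_norm_sum_le {s : ℂ → ℂ}
    (h : ∀ (S : Finset (Disk R)) (c : Disk R → ℂ),
      ‖∑ x ∈ S, (c x * conj (s x)) • RKHS.kerFun H x (1 : ℂ)‖ ≤
        ‖∑ x ∈ S, c x • RKHS.kerFun H x (1 : ℂ)‖) :
    IsContractiveMulOp (R := R) H s := by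
  set e := Finsupp.linearCombination ℂ fun x : Disk R ↦ RKHS.kerFun H x (1 : ℂ) with he
  set f := Finsupp.linearCombination ℂ
    fun x : Disk R ↦ conj (s x) • RKHS.kerFun H x (1 : ℂ) with hf
  have hfe : ∀ v, ‖f v‖ ≤ 1 * ‖e v‖ := by
    intro v
    simpa [he, hf, Finsupp.linearCombination_apply, Finsupp.sum, smul_smul] using h v.support v
  have hdense := RKHS.denseRange_linearCombination_kerFun_one H
  -- The extension by density is the candidate for the adjoint of `M_s`; its own adjoint is the
  -- multiplication.
  refine ⟨(f.extendOfNorm e).adjoint, fun g z ↦ ?_, ?_⟩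
  · have h1 : f.extendOfNorm e (RKHS.kerFun H z (1 : ℂ)) =
        conj (s z) • RKHS.kerFun H z (1 : ℂ) := by
      have := LinearMap.extendOfNorm_eq hdense ⟨1, hfe⟩ (Finsupp.single z 1)
      simpa [he, hf] using this
    have h2 := RKHS.kerFun_inner z (1 : ℂ) ((f.extendOfNorm e).adjoint g)
    rw [ContinuousLinearMap.adjoint_inner_right, h1, inner_smul_left, RKHS.kerFun_inner] at h2
    simpa using h2.symm
  · rw [LinearIsometryEquiv.norm_map]
    exact LinearMap.opNorm_extendOfNorm_le hdense zero_le_one hfe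

/-- Let `H` have the kernel `∑ bₙ (a z · conj (a w))ⁿ` on the disk of radius `1 / a`, where `b` is
nondecreasing and positive. The analytic contractive multipliers of `H` are the analytic functions
bounded by one. -/
theorem isContractiveMulOp_iff_isSchurFunction {a : ℝ} (ha : 0 < a) (haR : a * R = 1)
    {k : Disk R → Disk R → ℂ} (hk : RKHS.kernel H = scalarKernel k) {b : ℕ → ℝ}
    (hb : Monotone b) (hb0 : 0 < b 0)
    (hsum : ∀ z w : Disk R, HasSum (fun n ↦ (b n : ℂ) * ((a * z) * conj (a * w : ℂ)) ^ n) (k z w))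
    {s : ℂ → ℂ} (hs : AnalyticOnNhd ℂ s (Metric.ball 0 R)) :
    IsContractiveMulOp (R := R) H s ↔ IsSchurFunction fun z ↦ s (z / a) := by
  have ha' : (a : ℂ) ≠ 0 := by exact_mod_cast ha.ne'
  have hdiv : ∀ z ∈ Metric.ball (0 : ℂ) 1, z / a ∈ Metric.ball (0 : ℂ) R := by
    intro z hz
    rw [mem_ball_zero_iff] at hz ⊢
    rw [norm_div, Complex.norm_real, Real.norm_of_nonneg ha.le, div_lt_iff₀ ha, mul_comm, haR]
    exact hz
  have hmul : ∀ z : Disk R, (a : ℂ) * z ∈ Metric.ball (0 : ℂ) 1 := by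
    intro z
    have hz : ‖(z : ℂ)‖ < R := mem_ball_zero_iff.1 z.2
    rw [mem_ball_zero_iff, norm_mul, Complex.norm_real, Real.norm_of_nonneg ha.le, ← haR]
    exact mul_lt_mul_of_pos_left hz ha
  constructor
  · intro h
    refine ⟨fun z hz ↦ (hs _ (hdiv z hz)).comp_of_eq (by fun_prop (disch := exact ha')) rfl,
      fun z hz ↦ ?_⟩
    refine h.norm_le_one (z := ⟨z / a, hdiv z hz⟩) fun h0 ↦ ?_
    have hk0 : k ⟨z / a, hdiv z hz⟩ ⟨z / a, hdiv z hz⟩ = 0 := by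
      rw [← RKHS.inner_kerFun_one_kerFun_one hk, RKHS.kerFun_inner, RKHS.kerFun_apply, h0]
      simp
    have h1 := Complex.hasSum_re (hsum ⟨z / a, hdiv z hz⟩ ⟨z / a, hdiv z hz⟩)
    rw [hk0] at h1
    have hbn : ∀ n, 0 < b n := fun n ↦ hb0.trans_le (hb (Nat.zero_le n))
    have e : ∀ n, ((b n : ℂ) * ((a * (z / a : ℂ)) * conj (a * (z / a : ℂ))) ^ n).re =
        b n * (‖z‖ ^ 2) ^ n := by
      intro n
      rw [mul_div_cancel₀ _ ha', Complex.mul_conj', ← Complex.ofReal_pow, ← Complex.ofReal_pow,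
        ← Complex.ofReal_mul, Complex.ofReal_re]
    simp only [e] at h1
    -- The constant term `b 0 > 0` alone keeps the kernel from vanishing on the diagonal.
    have h2 := le_hasSum h1 0 fun n _ ↦ mul_nonneg (hbn n).le (by positivity)
    simp at h2
    linarith
  · intro hσ
    refine isContractiveMulOp_of_norm_sum_le fun S c ↦ ?_
    rw [← sq_le_sq₀ (norm_nonneg _) (norm_nonneg _), RKHS.norm_sq_sum_kerFun_one hk,
      RKHS.norm_sq_sum_kerFun_one hk]
    have hm := fun c : Disk R → ℂ ↦ (hasSum_weighted_moments S c (fun x : Disk R ↦ (a : ℂ) * x)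
      fun i _ j _ ↦ hsum i j).tsum_eq
    rw [← hm c, ← hm fun x ↦ c x * conj (s x)]
    have h := hσ.tsum_weighted_moments_le S c (fun x : Disk R ↦ (a : ℂ) * x) (fun x _ ↦ hmul x) hb
      hb0.le fun i _ j _ ↦ (hsum i j).summable
    simpa only [mul_div_cancel_left₀ _ ha'] using h

end Multipliers

/-! ### The spaces `H_{2,q}` and the Hardy space -/

/-- The coefficients of `E_q` in powers of `(1 - q) ζ` are nondecreasing. -/
theorem monotone_inv_qFactorial_mul_pow {q : ℝ} (hq0 : 0 ≤ q) (hq1 : q < 1) :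
    Monotone fun n ↦ (qFactorial q n * (1 - q) ^ n)⁻¹ := by
  refine monotone_nat_of_le_succ fun n ↦ ?_
  have h1 : 0 < 1 - q := by linarith
  have hp := qFactorial_pos hq0 n
  have hs : qFactorial q (n + 1) * (1 - q) ^ (n + 1) =
      qFactorial q n * (1 - q) ^ n * (1 - q ^ (n + 1)) := by
    -- The new factor is `(1 + q + ⋯ + qⁿ)(1 - q) = 1 - qⁿ⁺¹ ≤ 1`.
    rw [← mul_neg_geom_sum q (n + 1), qFactorial, Finset.prod_range_succ, ← qFactorial]
    ring
  have hp' := qFactorial_pos hq0 (n + 1)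
  refine inv_anti₀ (by positivity) ?_
  rw [hs]
  exact mul_le_of_le_one_right (by positivity) (by linarith [pow_nonneg hq0 (n + 1)])

theorem H2q.isContractiveMulOp_iff (q : Set.Ico (0 : ℝ) 1) {s : ℂ → ℂ}
    (hs : AnalyticOnNhd ℂ s (Metric.ball 0 (1 / √(1 - (q : ℝ))))) :
    IsContractiveMulOp (H2q q) s ↔ IsSchurFunction fun z ↦ s (z / (√(1 - (q : ℝ)) : ℂ)) := by
  have hq0 : 0 ≤ (q : ℝ) := q.2.1
  have hq1 : (q : ℝ) < 1 := q.2.2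
  have h1 : 0 < 1 - (q : ℝ) := by linarith
  have ha : 0 < √(1 - (q : ℝ)) := Real.sqrt_pos.2 h1
  refine isContractiveMulOp_iff_isSchurFunction (R := qRadius q) ha
    (by rw [qRadius, mul_one_div_cancel ha.ne'])
    (RKHS.OfKernel.kernel_ofKernel (K := qKernel (q : ℝ)))
    (monotone_inv_qFactorial_mul_pow hq0 hq1) (by simp [qFactorial]) (fun z w ↦ ?_) hs
  have hR : qRadius q ^ 2 = 1 / (1 - q) := by
    rw [qRadius, div_pow, one_pow, Real.sq_sqrt h1.le]
  refine (summable_qExp hq0 hq1 ((norm_mul_conj_lt z w).trans_eq hR)).hasSum.congr_fun fun n ↦ ?_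
  have hsq : ((√(1 - (q : ℝ)) : ℝ) : ℂ) * ((√(1 - (q : ℝ)) : ℝ) : ℂ) = ((1 - q : ℝ) : ℂ) := by
    rw [← Complex.ofReal_mul, Real.mul_self_sqrt h1.le]
  have e : ((√(1 - (q : ℝ)) : ℝ) : ℂ) * z * conj (((√(1 - (q : ℝ)) : ℝ) : ℂ) * (w : ℂ)) =
      ((1 - q : ℝ) : ℂ) * ((z : ℂ) * conj (w : ℂ)) := by
    rw [map_mul, Complex.conj_ofReal, ← hsq]
    ring
  have hne : ((1 - q : ℝ) : ℂ) ≠ 0 := by exact_mod_cast h1.ne'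
  have hf : (qFactorial q n : ℂ) ≠ 0 := by exact_mod_cast (qFactorial_pos hq0 n).ne'
  rw [e, mul_pow, Complex.ofReal_inv, Complex.ofReal_mul, Complex.ofReal_pow]
  field_simp

theorem HardyH2.isContractiveMulOp_iff {σ : ℂ → ℂ} (hσ : AnalyticOnNhd ℂ σ (Metric.ball 0 1)) :
    IsContractiveMulOp HardyH2 σ ↔ IsSchurFunction σ := by
  have h := isContractiveMulOp_iff_isSchurFunction (R := 1) (H := HardyH2) one_pos (mul_one 1)
    (RKHS.OfKernel.kernel_ofKernel (K := szegoKernel)) (b := fun _ ↦ 1) monotone_const one_pos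
    (fun z w ↦ by simpa using! hasSum_szego z.2 w.2) hσ
  simpa using h

theorem theorem8p3 (q : Set.Ico (0 : ℝ) 1) :
    (∀ s : ℂ → ℂ, AnalyticOnNhd ℂ s (Metric.ball 0 (1 / √(1 - (q : ℝ)))) →
      (IsContractiveMulOp (H2q q) s ↔
        IsSchurFunction fun z ↦ s (z / (√(1 - (q : ℝ)) : ℂ)))) ∧
    (∀ s : ℂ → ℂ, IsSchurMultiplier (H2q q) s ↔
      ∃ σ : ℂ → ℂ, IsSchurMultiplier HardyH2 σ ∧
        ∀ z ∈ Metric.ball (0 : ℂ) (1 / √(1 - (q : ℝ))), s z = σ ((√(1 - (q : ℝ)) : ℂ) * z)) := by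
  refine ⟨fun s hs ↦ H2q.isContractiveMulOp_iff q hs, fun s ↦ ?_⟩
  have h1 : 0 < 1 - (q : ℝ) := by linarith [q.2.2]
  have ha : 0 < √(1 - (q : ℝ)) := Real.sqrt_pos.2 h1
  have ha' : (√(1 - (q : ℝ)) : ℂ) ≠ 0 := by exact_mod_cast ha.ne'
  constructor
  · rintro ⟨hs, hM⟩
    have hσ := (H2q.isContractiveMulOp_iff q hs).1 hM
    refine ⟨_, ⟨hσ.1, (HardyH2.isContractiveMulOp_iff hσ.1).2 hσ⟩, fun z _ ↦ ?_⟩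
    rw [mul_div_cancel_left₀ _ ha']
  · rintro ⟨σ, ⟨hσ, hM⟩, hsσ⟩
    have hσ' := (HardyH2.isContractiveMulOp_iff hσ).1 hM
    have hmul : ∀ z ∈ Metric.ball (0 : ℂ) (1 / √(1 - (q : ℝ))),
        (√(1 - (q : ℝ)) : ℂ) * z ∈ Metric.ball (0 : ℂ) 1 := by
      intro z hz
      rw [mem_ball_zero_iff, lt_div_iff₀ ha] at hz
      rw [mem_ball_zero_iff, norm_mul, Complex.norm_real, Real.norm_of_nonneg ha.le, mul_comm]
      exact hz
    have hs : AnalyticOnNhd ℂ s (Metric.ball 0 (1 / √(1 - (q : ℝ)))) := by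
      have hcomp : AnalyticOnNhd ℂ (fun z ↦ σ ((√(1 - (q : ℝ)) : ℂ) * z))
          (Metric.ball 0 (1 / √(1 - (q : ℝ)))) :=
        fun z hz ↦ (hσ _ (hmul z hz)).comp_of_eq (by fun_prop) rfl
      exact hcomp.congr Metric.isOpen_ball fun z hz ↦ (hsσ z hz).symm
    refine ⟨hs, (H2q.isContractiveMulOp_iff q hs).2 ?_⟩
    -- The two functions need agree only on the open disk, so the Schur property is transferred by
    -- congruence there.
    have hEq : ∀ z ∈ Metric.ball (0 : ℂ) 1, σ z = s (z / (√(1 - (q : ℝ)) : ℂ)) := by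
      intro z hz
      rw [hsσ, mul_div_cancel₀ _ ha']
      rw [mem_ball_zero_iff] at hz ⊢
      rw [norm_div, Complex.norm_real, Real.norm_of_nonneg ha.le]
      gcongr
    exact ⟨hσ'.1.congr Metric.isOpen_ball hEq, fun z hz ↦
      (congrArg norm (hEq z hz)).symm.trans_le (hσ'.2 z hz)⟩
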